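/- Let $G$ be a computable group: an (infinite) countable group whose elements are numbered bijectively by $\mathbb{N}$ in such a way that the identity has number $0$ and multiplication is a computable function. Let $A$ be a finite alphabet. Fix an additively optimal reference machine and let $C$ denote plain Kolmogorov complexity with respect to it. Finite subsets of $G$ and words (maps $w\colon B\to A$ with $B\subset G$ finite) are computably encoded, a word $w$ being encoded as the pair consisting of its domain $B$ and the list of its letters in increasing order of the numbers of the elements of $B$. Let $\{F_n\}$ be a modest Følner sequence in $G$, that is, a sequence of nonempty finite subsets of $G$ with $$\lim_{n\to\infty}\frac{|F_n g\,\Delta\, F_n|}{|F_n|}=0\quad\text{for every } g\in G,\qquad\text{and}\qquad \lim_{n\to\infty}\frac{C(F_n)}{|F_n|}=0$$ (so $G$ is amenable). For $x\in A^G$ put $$hc(x)=\limsup_{n\to\infty}\frac{C(x|_{F_n})}{|F_n|}.$$ Let $\tau\colon A^G\to A^G$ be a cellular automaton: there are a finite set $S\subset G$ and a map $\mu\colon A^S\to A$ such that $\tau(x)(g)=\mu\bigl((g^{-1}x)|_S\bigr)$ for all $x\in A^G$ and $g\in G$, where $(gx)(h)=x(g^{-1}h)$. If $\tau$ has a Garden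 of Eden configuration (some $y\in A^G$ with $\tau^{-1}(y)=\varnothing$), then there exists $x\in A^G$ with $$hc(\tau(x))<hc(x).$$ -/

import Mathlib

open Filter Topology

/-! ### Plain Kolmogorov complexity -/

/-- A machine `U`, mapping binary programs to natural numbers, is an (additively) optimal reference
machine: it is partial recursive and it simulates every partial recursive machine with an
additive constant overhead in the length of programs. -/
def IsOptimalMachine (U : List Bool →. ℕ) : Prop :=
  Partrec U ∧ ∀ φ : List Bool →. ℕ, Partrec φ →
    ∃ c : ℕ, ∀ (p : List Bool) (m : ℕ), m ∈ φ p →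
      ∃ q : List Bool, m ∈ U q ∧ q.length ≤ p.length + c

/-- The plain Kolmogorov complexity, with respect to the reference machine `U`, of an object of an
effectively coded type: the least length of a program that makes `U` print the code of `a`. -/
noncomputable def plainComplexity (U : List Bool →. ℕ) {α : Type*} [Primcodable α] (a : α) : ℕ :=
  sInf {l : ℕ | ∃ p : List Bool, Encodable.encode a ∈ U p ∧ p.length = l}

/-- For an optimal machine every object has a program, so the infimum above is a minimum. -/
theorem IsOptimalMachine.exists_program {U : List Bool →. ℕ} (hU : IsOptimalMachine U)
    {α : Type*} [Primcodable α] (a : α) :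
    ∃ p : List Bool, Encodable.encode a ∈ U p ∧ p.length = plainComplexity U a := by
  have hne : {l : ℕ | ∃ p : List Bool, Encodable.encode a ∈ U p ∧ p.length = l}.Nonempty := by
    obtain ⟨c, hc⟩ := hU.2 (fun _ => Part.some (Encodable.encode a))
      (Computable.const (Encodable.encode a)).partrec
    obtain ⟨q, hq, -⟩ := hc [] (Encodable.encode a) (Part.mem_some _)
    exact ⟨q.length, q, hq, rfl⟩
  exact Nat.sInf_mem hne

/-- The program `1ⁿ0p` of this machine runs the `n`-th partial recursive function on `p`. -/
def universalMachine : List Bool →. ℕ := fun q =>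
  (Denumerable.ofNat Nat.Partrec.Code (q.findIdx (fun b => !b))).eval
    (Encodable.encode (q.drop (q.findIdx (fun b => !b) + 1)))

/-- Optimal machines exist. -/
theorem isOptimalMachine_universalMachine : IsOptimalMachine universalMachine := by
  refine ⟨?_, ?_⟩
  · have hidx : Primrec (fun q : List Bool => q.findIdx (fun b => !b)) :=
      Primrec.list_findIdx Primrec.id (Primrec.not.comp Primrec.snd).to₂
    have hdrop : Primrec (fun q : List Bool => q.drop (q.findIdx (fun b => !b) + 1)) :=
      Primrec.list_drop.comp (Primrec.succ.comp hidx) Primrec.id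
    exact Nat.Partrec.Code.eval_part.comp
      ((Primrec.ofNat Nat.Partrec.Code).comp hidx).to_comp
      (Primrec.encode.comp hdrop).to_comp
  · intro φ hφ
    obtain ⟨c, hc⟩ := Nat.Partrec.Code.exists_code.1 hφ
    refine ⟨Encodable.encode c + 1, fun p m hm =>
      ⟨List.replicate (Encodable.encode c) true ++ false :: p, ?_, ?_⟩⟩
    · have h1 : (List.replicate (Encodable.encode c) true ++ false :: p).findIdx (fun b => !b)
          = Encodable.encode c := by
        induction Encodable.encode c with
        | zero => simp [List.findIdx_cons]
        | succ n ih => simp [List.replicate_succ, List.findIdx_cons, ih]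
      simp only [universalMachine, h1]
      simp [hc, hm, List.drop_append]
    · simp; omega

/-! ### Computable groups -/

/-- The group `G`, whose elements are numbered bijectively by `ℕ` through `Denumerable G`, is a
computable group: the identity has number `0` and multiplication is computable. -/
def IsComputableGroup (G : Type*) [Group G] [Denumerable G] : Prop :=
  Encodable.encode (1 : G) = 0 ∧ Computable₂ (fun x y : G => x * y)

section Words

variable {G : Type*} [Denumerable G] {A : Type*}

/-- A finite subset of `G`, presented as the increasing list of the numbers of its elements. -/
noncomputable def finsetCode (B : Finset G) : List ℕ :=
  (B.map (Denumerable.eqv G).toEmbedding).sort (· ≤ ·)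

/-- The content of the word `x|_B`: its letters, listed in increasing order of the numbers of the
elements of `B`. -/
noncomputable def wordContent (x : G → A) (B : Finset G) : List A :=
  (finsetCode B).map (fun m => x (Denumerable.ofNat G m))

/-- The complexity `C(B)` of a finite subset `B` of `G`. -/
noncomputable def finsetComplexity (U : List Bool →. ℕ) (B : Finset G) : ℕ :=
  plainComplexity U (finsetCode B)

/-- The complexity `C(x|_B)` of the word `x|_B`, that is, of the pair of its domain and its
content. -/
noncomputable def wordComplexity (U : List Bool →. ℕ) [Primcodable A] (x : G → A)
    (B : Finset G) : ℕ :=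
  plainComplexity U (finsetCode B, wordContent x B)

/-- The asymptotic complexity `hc(x) = limsup C(x|_{F n}) / |F n|`. -/
noncomputable def asymptoticComplexity (U : List Bool →. ℕ) [Primcodable A] (F : ℕ → Finset G)
    (x : G → A) : EReal :=
  limsup (fun n => (((wordComplexity U x (F n) : ℝ) / ((F n).card : ℝ) : ℝ) : EReal)) atTop

end Words

/-! ### Følner sequences -/

/-- A (right) Følner sequence of nonempty finite subsets of `G`. -/
def IsFolnerSequence {G : Type*} [Group G] [DecidableEq G] (F : ℕ → Finset G) : Prop :=
  (∀ n, (F n).Nonempty) ∧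
  ∀ g : G, Tendsto (fun n =>
    ((symmDiff ((F n).image (fun f => f * g)) (F n)).card : ℝ) / ((F n).card : ℝ)) atTop (𝓝 0)

/-- A Følner sequence is modest if `C(F n) / |F n| → 0`. -/
def IsModestFolnerSequence (U : List Bool →. ℕ) {G : Type*} [Group G] [Denumerable G]
    [DecidableEq G] (F : ℕ → Finset G) : Prop :=
  IsFolnerSequence F ∧
  Tendsto (fun n => (finsetComplexity U (F n) : ℝ) / ((F n).card : ℝ)) atTop (𝓝 0)

/-! ### Cellular automata -/

/-- The left action of `G` on configurations. -/
def shift {G A : Type*} [Group G] (g : G) (x : G → A) : G → A := fun h => x (g⁻¹ * h)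

/-- `τ` is a cellular automaton: it has a finite memory set `S` and a rule `μ`. -/
def IsCellularAutomaton {G A : Type*} [Group G] (τ : (G → A) → (G → A)) : Prop :=
  ∃ (S : Finset G) (μ : (S → A) → A),
    ∀ (x : G → A) (g : G), τ x g = μ (fun s : S => shift g⁻¹ x s)

/-- A Garden of Eden configuration: one without preimage. -/
def IsGardenOfEden {G A : Type*} (τ : (G → A) → (G → A)) (y : G → A) : Prop :=
  τ ⁻¹' {y} = ∅

/-! Write `a = |A|`. The image of `τ` is compact, hence closed, and shift-invariant, so a Garden of
Eden configuration `y` has a finite pattern `y|_E` that occurs at no place in any `τ x`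
(`IsCellularAutomaton.exists_avoided_pattern`).

For large `n`, a maximal family of disjoint translates of `E` inside `F n` has at least `|F n| /
(2|E|²)` members. Each of them excludes one of `a ^ |E|` contents, so at most `2 ^ ((log₂ a - δ')|F
n|)` words on `F n` avoid the pattern. These words can be listed computably from `F n`, and an
avoiding word is described by its domain and its rank in the list. Modesty makes the cost of the
domain negligible, so `hc(τ x) ≤ log₂ a - δ'` for every `x` (`exists_asymptoticComplexity_le`).

Counting programs and a Baire category argument give an `x` with `hc(x) ≥ log₂ a`
(`IsOptimalMachine.exists_le_asymptoticComplexity`). -/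

/-! ### Computable listing of the words that avoid a pattern -/

theorem Computable.list_map {α β γ : Type*} [Primcodable α] [Primcodable β] [Primcodable γ]
    {f : α → List β} {g : α → β → γ} (hf : Computable f) (hg : Computable₂ g) :
    Computable fun a => (f a).map (g a) := by
  have hstep : Computable₂ fun (a : α) (q : ℕ × List γ) =>
      (((f a)[q.1]?).map fun b => q.2 ++ [g a b]).getD q.2 := by
    refine Computable.option_getD (Computable.option_map (Computable.list_getElem?.comp
      (hf.comp Computable.fst) (Computable.fst.comp Computable.snd)) ?_)
      (Computable.snd.comp Computable.snd)
    exact Computable.list_concat.comp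
      (Computable.snd.comp (Computable.snd.comp Computable.fst))
      (hg.comp (Computable.fst.comp Computable.fst) Computable.snd)
  refine (Computable.nat_rec (Computable.list_length.comp hf) (Computable.const ([] : List γ))
    hstep).of_eq fun a => ?_
  have key : ∀ n ≤ (f a).length, (Nat.rec [] (fun y IH =>
      (((f a)[y]?).map fun b => IH ++ [g a b]).getD IH) n : List γ)
        = ((f a).take n).map (g a) := by
    intro n
    induction n with
    | zero => simp
    | succ n ih =>
      intro hn
      have hn' : n < (f a).length := hn
      simp only [ih hn'.le, List.getElem?_eq_getElem hn', Option.map_some, Option.getD_some]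
      rw [← List.map_singleton, ← List.map_append, List.take_concat_get' _ _ hn']
  simpa using key _ le_rfl

/-- The words of length `n` over the letters in `l`. -/
def wordsOfLength {A : Type*} (l : List A) : ℕ → List (List A)
  | 0 => [[]]
  | n + 1 => l.flatMap fun a => (wordsOfLength l n).map (a :: ·)

theorem mem_wordsOfLength {A : Type*} {l : List A} {n : ℕ} {w : List A} :
    w ∈ wordsOfLength l n ↔ w.length = n ∧ ∀ a ∈ w, a ∈ l := by
  induction n generalizing w with
  | zero => simp +contextual [wordsOfLength]
  | succ n ih =>
    cases w with
    | nil => simp [wordsOfLength]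
    | cons b w => simp [wordsOfLength, ih]; tauto

theorem nodup_wordsOfLength {A : Type*} {l : List A} (hl : l.Nodup) (n : ℕ) :
    (wordsOfLength l n).Nodup := by
  induction n with
  | zero => simp [wordsOfLength]
  | succ n ih =>
    rw [wordsOfLength, List.nodup_flatMap]
    refine ⟨fun a _ => ih.map (List.cons_injective), ?_⟩
    refine hl.imp fun hab => ?_
    simp only [Function.onFun, List.disjoint_left, List.mem_map]
    rintro _ ⟨u, _, rfl⟩ ⟨v, _, h⟩
    exact hab (List.cons.inj h).1.symm

theorem primrec_wordsOfLength {A : Type*} [Primcodable A] (l : List A) :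
    Primrec (wordsOfLength l) := by
  refine (Primrec.nat_rec₁ [[]] (f := fun _ r => l.flatMap fun a => r.map (a :: ·)) ?_).of_eq
    fun n => ?_
  · exact Primrec.list_flatMap (Primrec.const l)
      (Primrec.list_map (Primrec.snd.comp Primrec.fst)
        (Primrec.list_cons.comp (Primrec.snd.comp Primrec.fst) Primrec.snd))
  · induction n with
    | zero => rfl
    | succ n ih => simp only [wordsOfLength, ← ih]

/-- The word `w` on the domain listed by `F` carries the pattern listed by `r`. -/
def PatternOccurs {A : Type*} (F : List ℕ) (w : List A) (r : List (ℕ × A)) : Prop :=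
  ∀ q ∈ r, ∃ j ∈ List.range F.length, F[j]? = some q.1 ∧ w[j]? = some q.2

open Classical in
/-- The words on the domain listed by `F` which carry none of the patterns in `M`. -/
noncomputable def avoidingWords {A : Type*} (l : List A) (F : List ℕ)
    (M : List (List (ℕ × A))) : List (List A) :=
  (wordsOfLength l F.length).filter fun w => ∀ r ∈ M, ¬ PatternOccurs F w r

theorem primrecPred_patternOccurs {A : Type*} [Primcodable A] :
    PrimrecRel fun (r : List (ℕ × A)) (b : List ℕ × List A) => PatternOccurs b.1 b.2 r := by
  have h1 : PrimrecRel fun (j : ℕ) (c : (ℕ × A) × (List ℕ × List A)) =>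
      c.2.1[j]? = some c.1.1 ∧ c.2.2[j]? = some c.1.2 := by
    refine PrimrecPred.and ?_ ?_
    · exact Primrec.eq.comp (Primrec.list_getElem?.comp
        (Primrec.fst.comp (Primrec.snd.comp Primrec.snd)) Primrec.fst)
        (Primrec.option_some.comp (Primrec.fst.comp (Primrec.fst.comp Primrec.snd)))
    · exact Primrec.eq.comp (Primrec.list_getElem?.comp
        (Primrec.snd.comp (Primrec.snd.comp Primrec.snd)) Primrec.fst)
        (Primrec.option_some.comp (Primrec.snd.comp (Primrec.fst.comp Primrec.snd)))
  have h2 : PrimrecRel fun (q : ℕ × A) (b : List ℕ × List A) =>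
      ∃ j ∈ List.range b.1.length, b.1[j]? = some q.1 ∧ b.2[j]? = some q.2 :=
    PrimrecRel.comp h1.exists_mem_list (f := fun p : (ℕ × A) × (List ℕ × List A) =>
      List.range p.2.1.length) (g := fun p => p)
      (Primrec.list_range.comp (Primrec.list_length.comp (Primrec.fst.comp Primrec.snd))) Primrec.id
  exact h2.forall_mem_list

theorem primrec_avoidingWords {A : Type*} [Primcodable A] (l : List A) :
    Primrec₂ (avoidingWords l) := by
  classical
  have h1 : PrimrecRel fun (r : List (ℕ × A)) (b : List ℕ × List A) =>
      ¬ PatternOccurs b.1 b.2 r := PrimrecPred.not primrecPred_patternOccurs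
  have h2 : PrimrecRel fun (w : List A) (p : List ℕ × List (List (ℕ × A))) =>
      ∀ r ∈ p.2, ¬ PatternOccurs p.1 w r :=
    PrimrecRel.comp h1.forall_mem_list
      (f := fun c : List A × (List ℕ × List (List (ℕ × A))) => c.2.2)
      (g := fun c => (c.2.1, c.1))
      (Primrec.snd.comp Primrec.snd) (Primrec.pair (Primrec.fst.comp Primrec.snd) Primrec.fst)
  have h3 : Primrec fun b : List ℕ × List (List (ℕ × A)) => wordsOfLength l b.1.length :=
    (primrec_wordsOfLength l).comp (Primrec.list_length.comp Primrec.fst)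
  refine ((PrimrecRel.listFilter h2).comp h3 Primrec.id).of_eq fun b => ?_
  simp only [avoidingWords]
  congr!

/-- The patterns `p` translated by the elements numbered by `F`. -/
def translatedPatterns {G A : Type*} [Group G] [Denumerable G] (p : List (G × A)) (F : List ℕ) :
    List (List (ℕ × A)) :=
  F.map fun m => p.map fun q => (Encodable.encode (Denumerable.ofNat G m * q.1), q.2)

/-- The only place where computability of the multiplication enters; filtering the words against the
resulting list is primitive recursive. -/
theorem computable_translatedPatterns {G A : Type*} [Group G] [Denumerable G] [Primcodable A]
    (hG : IsComputableGroup G) (p : List (G × A)) :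
    Computable (translatedPatterns p) := by
  refine Computable.list_map Computable.id ?_
  refine Computable.list_map (Computable.const p) ?_
  refine Computable.pair ?_ (Computable.snd.comp Computable.snd)
  exact Computable.encode.comp (hG.2.comp ((Computable.ofNat G).comp
    (Computable.snd.comp Computable.fst)) (Computable.fst.comp Computable.snd))

theorem computable_avoidingWords {G A : Type*} [Group G] [Denumerable G] [Primcodable A]
    (hG : IsComputableGroup G) (l : List A) (p : List (G × A)) :
    Computable fun F => avoidingWords l F (translatedPatterns p F) :=
  (primrec_avoidingWords l).to_comp.comp Computable.id (computable_translatedPatterns hG p)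

/-! ### Upper and lower bounds for complexity -/

/-- The number with binary digits `l`, the least significant one first. -/
def bitsToNat (l : List Bool) : ℕ := l.foldr (fun b n => cond b (2 * n + 1) (2 * n)) 0

theorem primrec_bitsToNat : Primrec bitsToNat := by
  have h : Primrec fun c : List Bool × Bool × ℕ => 2 * c.2.2 :=
    Primrec.nat_mul.comp (Primrec.const 2) (Primrec.snd.comp Primrec.snd)
  have hstep : Primrec₂ fun (_ : List Bool) (q : Bool × ℕ) => cond q.1 (2 * q.2 + 1) (2 * q.2) :=
    Primrec.cond (Primrec.fst.comp Primrec.snd) (Primrec.succ.comp h) h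
  exact Primrec.list_foldr Primrec.id (Primrec.const 0) hstep

theorem bitsToNat_bits (n : ℕ) : bitsToNat n.bits = n := by
  induction n using Nat.binaryRec' with
  | zero => simp [bitsToNat]
  | bit b n h ih =>
    rw [Nat.bits_append_bit _ _ h]
    simp only [bitsToNat, List.foldr_cons] at ih ⊢
    rw [ih]
    cases b <;> simp [Nat.bit]

/-- Splitting a concatenation whose first part is preceded by its length in unary. -/
def splitProgram (p : List Bool) : List Bool × List Bool :=
  let k := p.findIdx (fun b => !b)
  ((p.drop (k + 1)).take k, (p.drop (k + 1)).drop k)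

theorem primrec_splitProgram : Primrec splitProgram := by
  have hk : Primrec (fun q : List Bool => q.findIdx (fun b => !b)) :=
    Primrec.list_findIdx Primrec.id (Primrec.not.comp Primrec.snd).to₂
  have hd : Primrec (fun q : List Bool => q.drop (q.findIdx (fun b => !b) + 1)) :=
    Primrec.list_drop.comp (Primrec.succ.comp hk) Primrec.id
  exact Primrec.pair (Primrec.list_take.comp hk hd) (Primrec.list_drop.comp hk hd)

theorem splitProgram_append (q r : List Bool) :
    splitProgram (List.replicate q.length true ++ false :: (q ++ r)) = (q, r) := by
  have h1 (n : ℕ) (s : List Bool) :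
      (List.replicate n true ++ false :: s).findIdx (fun b => !b) = n := by
    induction n with
    | zero => simp [List.findIdx_cons]
    | succ n ih => simp [List.replicate_succ, List.findIdx_cons, ih]
  simp only [splitProgram, h1]
  simp [List.drop_append]

/-- A word in a computable list attached to its domain is described by its domain and its position
in the list. -/
theorem IsOptimalMachine.exists_complexity_le {U : List Bool →. ℕ} (hU : IsOptimalMachine U)
    {α β : Type*} [Primcodable α] [Primcodable β] {W : α → List β} (hW : Computable W) :
    ∃ c : ℕ, ∀ (a : α) (b : β), b ∈ W a →
      plainComplexity U (a, b) ≤ 2 * plainComplexity U a + Nat.size (W a).length + c := by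
  let dec : ℕ → ℕ → Option ℕ := fun m i =>
    (Encodable.decode (α := α) m).bind fun a => ((W a)[i]?).map fun b => Encodable.encode (a, b)
  have hdec : Computable₂ dec := by
    refine Computable.option_bind (Computable.decode.comp Computable.fst) ?_
    refine Computable.option_map (Computable.list_getElem?.comp (hW.comp Computable.snd)
      (Computable.snd.comp Computable.fst)) ?_
    exact Computable.encode.comp (Computable.pair (Computable.snd.comp Computable.fst)
      Computable.snd)
  let φ : List Bool →. ℕ := fun p =>
    (U (splitProgram p).1).bind fun m => (dec m (bitsToNat (splitProgram p).2) : Part ℕ)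
  have hφ : Partrec φ := by
    refine Partrec.bind (hU.1.comp (Computable.fst.comp primrec_splitProgram.to_comp)) ?_
    refine Computable.ofOption (hdec.comp Computable.snd ?_)
    exact primrec_bitsToNat.to_comp.comp
      (Computable.snd.comp (primrec_splitProgram.to_comp.comp Computable.fst))
  obtain ⟨c, hc⟩ := hU.2 φ hφ
  refine ⟨1 + c, fun a b hb => ?_⟩
  obtain ⟨q, hq, hql⟩ := hU.exists_program a
  obtain ⟨i, hi, rfl⟩ := List.getElem_of_mem hb
  -- The unary length prefix makes `q` self-delimiting at the price of doubling it and adding one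
  -- separator bit; the rank `i` is paid for once, in binary.
  obtain ⟨r, hr, hrl⟩ := hc (List.replicate q.length true ++ false :: (q ++ i.bits))
    (Encodable.encode (a, (W a)[i])) (by
      simp only [φ, splitProgram_append, Part.mem_bind_iff]
      refine ⟨_, hq, ?_⟩
      simp [dec, bitsToNat_bits, List.getElem?_eq_getElem hi])
  have h1 : plainComplexity U (a, (W a)[i]) ≤ r.length := Nat.sInf_le ⟨r, hr, rfl⟩
  have h2 : i.bits.length ≤ Nat.size (W a).length := by
    rw [Nat.size_eq_bits_len]; exact Nat.size_le_size hi.le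
  simp only [List.length_append, List.length_replicate, List.length_cons] at hrl
  omega

/-- There are few objects of small complexity. -/
theorem IsOptimalMachine.exists_le_complexity {U : List Bool →. ℕ} (hU : IsOptimalMachine U)
    {α : Type*} [Primcodable α] {L : ℕ} (s : Finset α) (hs : 2 ^ L ≤ s.card) :
    ∃ a ∈ s, L ≤ plainComplexity U a := by
  by_contra! h
  choose p hp hpl using fun a : α => hU.exists_program a
  have hinj : Function.Injective p := fun a b hab =>
    Encodable.encode_injective (Part.mem_unique (hp a) (hab ▸ hp b))
  -- Programs of distinct objects are distinct, and there are only `2 ^ L - 1` binary strings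
  -- shorter than `L`.
  let f : s → Σ l : Fin L, (Fin l → Bool) := fun a =>
    ⟨⟨(p a).length, by rw [hpl]; exact h a a.2⟩, (p a).get⟩
  have hf : Function.Injective f := by
    intro a b hab
    refine Subtype.ext (hinj ?_)
    have := congrArg (fun z : Σ l : Fin L, (Fin l → Bool) => List.ofFn z.2) hab
    simpa [f] using this
  have := Fintype.card_le_of_injective f hf
  simp only [Fintype.card_coe, Fintype.card_sigma, Fintype.card_fun, Fintype.card_bool,
    Fintype.card_fin] at this
  rw [Fin.sum_univ_eq_sum_range (fun i => 2 ^ i) L] at this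
  have h3 := Nat.geomSum_lt (m := 2) (n := L) (s := Finset.range L) le_rfl (by simp)
  omega

/-! ### Compactness: a finite pattern absent from the image -/

/-- The image of a cellular automaton with a Garden of Eden configuration avoids, at all places,
some finite pattern of that configuration. -/
theorem IsCellularAutomaton.exists_avoided_pattern {G A : Type*} [Group G] [Finite A]
    {τ : (G → A) → (G → A)} (hτ : IsCellularAutomaton τ) {y : G → A} (hy : IsGardenOfEden τ y) :
    ∃ E : Finset G, (1 : G) ∈ E ∧ ∀ (x : G → A) (g : G), ∃ e ∈ E, τ x (g * e) ≠ y e := by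
  classical
  obtain ⟨S, μ, hμ⟩ := hτ
  let _ : TopologicalSpace A := ⊥
  have : DiscreteTopology A := ⟨rfl⟩
  have hcont : Continuous τ := by
    refine continuous_pi fun g => ?_
    simp only [hμ]
    refine (continuous_of_discreteTopology (f := μ)).comp (continuous_pi fun s => ?_)
    exact continuous_apply _
  have hclosed : IsClosed (Set.range τ) := (isCompact_range hcont).isClosed
  have hmem : y ∈ (Set.range τ)ᶜ := by
    rintro ⟨x, hx⟩
    have : x ∈ τ ⁻¹' {y} := hx
    rw [hy] at this
    exact this
  obtain ⟨I, u, hu, hsub⟩ := isOpen_pi_iff.1 hclosed.isOpen_compl y hmem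
  -- With `1 ∈ E`, a translate `t * E` contained in `B` has its base point `t` in `B`, and only such
  -- base points are listed by `translatedPatterns`.
  refine ⟨insert 1 I, Finset.mem_insert_self _ _, fun x g => ?_⟩
  by_contra! h
  have heq : ∀ e : G, τ (shift g⁻¹ x) e = τ x (g * e) := by
    intro e
    rw [hμ, hμ]
    congr 1
    funext s
    simp [shift, mul_assoc]
  refine hsub (a := τ (shift g⁻¹ x)) (fun e he => ?_) ⟨_, rfl⟩
  rw [heq, h e (Finset.mem_insert_of_mem he)]
  exact (hu e he).2

/-! ### Counting pattern-avoiding words -/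

section Counting

variable {G : Type*} [Denumerable G] {A : Type*}

theorem encode_mem_finsetCode {B : Finset G} {g : G} :
    Encodable.encode g ∈ finsetCode B ↔ g ∈ B := by
  simp [finsetCode, Denumerable.eqv]

theorem mem_finsetCode {B : Finset G} {m : ℕ} :
    m ∈ finsetCode B ↔ Denumerable.ofNat G m ∈ B := by
  rw [← encode_mem_finsetCode, Denumerable.encode_ofNat]

theorem length_finsetCode (B : Finset G) : (finsetCode B).length = B.card := by
  simp [finsetCode]

/-- Words of length `n` which differ from a given pattern on each of several disjoint blocks. -/
theorem card_avoiding_blocks_le {ι κ : Type*} [Fintype ι] [Fintype κ] [Finite A] {n : ℕ}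
    (pos : ι × κ → Fin n) (hpos : Function.Injective pos) (p : κ → A) :
    Nat.card {w : Fin n → A // ∀ i, ∃ k, w (pos (i, k)) ≠ p k} ≤
      (Nat.card A ^ Fintype.card κ - 1) ^ Fintype.card ι *
        Nat.card A ^ (n - Fintype.card ι * Fintype.card κ) := by
  classical
  have := Fintype.ofFinite A
  -- A word is determined by its contents on the blocks, each different from `p`, together with its
  -- letters off the blocks.
  let f : {w : Fin n → A // ∀ i, ∃ k, w (pos (i, k)) ≠ p k} →
      (ι → {q : κ → A // q ≠ p}) × ({j // j ∉ Finset.univ.image pos} → A) := fun w =>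
    (fun i => ⟨fun k => w.1 (pos (i, k)), fun h => by
      obtain ⟨k, hk⟩ := w.2 i
      exact hk (congrFun h k)⟩, fun j => w.1 j)
  have hf : Function.Injective f := by
    intro w v h
    ext j
    by_cases hj : j ∈ Finset.univ.image pos
    · obtain ⟨⟨i, k⟩, -, rfl⟩ := Finset.mem_image.1 hj
      exact congrFun (congrArg Subtype.val (congrFun (congrArg Prod.fst h) i)) k
    · exact congrFun (congrArg Prod.snd h) ⟨j, hj⟩
  have := Nat.card_le_card_of_injective f hf
  refine this.trans_eq ?_
  have h1 : Fintype.card {q : κ → A // q ≠ p} = Fintype.card A ^ Fintype.card κ - 1 := by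
    rw [Fintype.card_subtype_compl, Fintype.card_subtype_eq, Fintype.card_fun]
  have h2 : Fintype.card {j // j ∉ Finset.univ.image pos} =
      n - Fintype.card ι * Fintype.card κ := by
    rw [Fintype.card_subtype_compl, Fintype.card_coe, Finset.card_image_of_injective _ hpos,
      Finset.card_univ, Fintype.card_prod, Fintype.card_fin]
  rw [Nat.card_prod, Nat.card_eq_fintype_card, Nat.card_eq_fintype_card, Fintype.card_fun,
    Fintype.card_fun, h1, h2, Nat.card_eq_fintype_card]

variable [Group G]

/-- The list of the pairs which make up the pattern `y|_E`. -/
noncomputable def patternList (y : G → A) (E : Finset G) : List (G × A) :=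
  E.toList.map fun e => (e, y e)

/-- The contents of the words on `B` in which no translate of `y|_E` occurs. -/
noncomputable def wordsAvoidingPattern [Fintype A] (y : G → A) (E B : Finset G) : List (List A) :=
  avoidingWords Finset.univ.toList (finsetCode B)
    (translatedPatterns (patternList y E) (finsetCode B))

theorem wordContent_mem_wordsAvoidingPattern [Fintype A] {y z : G → A} {E : Finset G}
    (h : ∀ g, ∃ e ∈ E, z (g * e) ≠ y e) (B : Finset G) :
    wordContent z B ∈ wordsAvoidingPattern y E B := by
  simp only [wordsAvoidingPattern, avoidingWords, List.mem_filter, mem_wordsOfLength,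
    decide_eq_true_eq]
  refine ⟨⟨by simp [wordContent], by simp⟩, fun r hr hocc => ?_⟩
  simp only [translatedPatterns, patternList, List.mem_map, List.map_map] at hr
  obtain ⟨m, -, rfl⟩ := hr
  obtain ⟨e, he, hne⟩ := h (Denumerable.ofNat G m)
  obtain ⟨j, -, hj1, hj2⟩ := hocc (Encodable.encode (Denumerable.ofNat G m * e), y e)
    (List.mem_map.2 ⟨e, by simpa using he, rfl⟩)
  simp only [wordContent, List.getElem?_map] at hj2
  rw [hj1] at hj2
  exact hne (by simpa using hj2)

/-- The translates `t * E` occupy disjoint blocks of positions in the list coding `B`, so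
`card_avoiding_blocks_le` applies. -/
theorem length_wordsAvoidingPattern_le [Fintype A] (y : G → A) {E B T : Finset G}
    (h1 : (1 : G) ∈ E) (hT : ∀ t ∈ T, ∀ e ∈ E, t * e ∈ B)
    (hdisj : ∀ t ∈ T, ∀ t' ∈ T, ∀ e ∈ E, ∀ e' ∈ E, t * e = t' * e' → t = t') :
    (wordsAvoidingPattern y E B).length ≤
      (Fintype.card A ^ E.card - 1) ^ T.card * Fintype.card A ^ (B.card - T.card * E.card) := by
  classical
  have hmem : ∀ a : T × E, Encodable.encode ((a.1 : G) * a.2) ∈ finsetCode B := fun a =>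
    encode_mem_finsetCode.2 (hT _ a.1.2 _ a.2.2)
  let pos : T × E → Fin B.card := fun a =>
    ⟨(finsetCode B).idxOf (Encodable.encode ((a.1 : G) * a.2)), by
      rw [← length_finsetCode]; exact List.idxOf_lt_length_of_mem (hmem a)⟩
  have hget : ∀ a, (finsetCode B)[(pos a : ℕ)]? = some (Encodable.encode ((a.1 : G) * a.2)) :=
    fun a => List.getElem?_idxOf (hmem a)
  have hpos : Function.Injective pos := by
    intro a b hab
    have h := hget a
    rw [hab, hget b, Option.some_inj] at h
    have h' := (Encodable.encode_injective h).symm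
    have ht : (a.1 : G) = b.1 := hdisj _ a.1.2 _ b.1.2 _ a.2.2 _ b.2.2 h'
    rw [ht] at h'
    exact Prod.ext (Subtype.ext ht) (Subtype.ext (mul_left_cancel h'))
  have key := card_avoiding_blocks_le pos hpos fun e : E => y e
  rw [Nat.card_eq_fintype_card, Nat.card_eq_fintype_card, Fintype.card_coe, Fintype.card_coe]
    at key
  refine le_trans ?_ key
  -- Without repetitions, the length of the list is the number of words.
  have hnodup : (wordsAvoidingPattern y E B).Nodup :=
    (nodup_wordsOfLength (Finset.nodup_toList _) _).filter _
  rw [← List.toFinset_card_of_nodup hnodup, ← Fintype.card_coe]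
  have hlen : ∀ w ∈ wordsAvoidingPattern y E B, w.length = B.card := by
    intro w hw
    simp only [wordsAvoidingPattern, avoidingWords, List.mem_filter, mem_wordsOfLength] at hw
    rw [hw.1.1, length_finsetCode]
  have hlen' : ∀ w : (wordsAvoidingPattern y E B).toFinset, B.card = w.1.length :=
    fun w => (hlen _ (List.mem_toFinset.1 w.2)).symm
  refine Fintype.card_le_of_injective
    (fun w => ⟨fun j => w.1.get (j.cast (hlen' w)), fun t => ?_⟩) ?_
  · have hw := List.mem_toFinset.1 w.2
    simp only [wordsAvoidingPattern, avoidingWords, List.mem_filter, decide_eq_true_eq] at hw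
    by_contra! hall
    refine hw.2 _ (List.mem_map.2 ⟨Encodable.encode (t : G),
      encode_mem_finsetCode.2 (by simpa using hT t t.2 1 h1), rfl⟩) fun q hq => ?_
    simp only [patternList, List.map_map, List.mem_map, Finset.mem_toList] at hq
    obtain ⟨e, he, rfl⟩ := hq
    have hlt : (pos (t, ⟨e, he⟩) : ℕ) < w.1.length := by rw [← hlen' w]; exact Fin.is_lt _
    refine ⟨pos (t, ⟨e, he⟩), ?_, ?_, ?_⟩
    · rw [List.mem_range, length_finsetCode]; exact Fin.is_lt _
    · simpa using hget (t, ⟨e, he⟩)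
    · rw [List.getElem?_eq_getElem hlt]
      exact congrArg some (hall ⟨e, he⟩)
  · intro w v h
    refine Subtype.ext (List.ext_get ((hlen' w).symm.trans (hlen' v)) fun j hj hj' => ?_)
    exact congrFun (congrArg Subtype.val h) ⟨j, by rwa [hlen' w]⟩

end Counting

/-! ### Disjoint translates and Følner sets -/

/-- A maximal family of disjoint translates of `E`, based in `I`, is large. -/
theorem exists_disjoint_translates {G : Type*} [Group G] (E I : Finset G) (hE : E.Nonempty) :
    ∃ T ⊆ I, (∀ t ∈ T, ∀ t' ∈ T, ∀ e ∈ E, ∀ e' ∈ E, t * e = t' * e' → t = t') ∧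
      I.card ≤ T.card * (E.card * E.card) := by
  classical
  let P : Finset G → Prop := fun T =>
    ∀ t ∈ T, ∀ t' ∈ T, ∀ e ∈ E, ∀ e' ∈ E, t * e = t' * e' → t = t'
  obtain ⟨T, hT⟩ := Finset.exists_maximal (s := I.powerset.filter P) ⟨∅, by simp [P]⟩
  have hTm := Finset.mem_filter.1 hT.1
  have hTI := Finset.mem_powerset.1 hTm.1
  refine ⟨T, hTI, hTm.2, ?_⟩
  -- By maximality each `g * E` with `g ∈ I` meets some `t * E`, so `I ⊆ T E E⁻¹`; hence the factor
  -- `|E|²`.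
  have hcov : I ⊆ (T ×ˢ (E ×ˢ E)).image fun a => a.1 * a.2.1 * a.2.2⁻¹ := by
    intro g hg
    by_contra hno
    simp only [Finset.mem_image, Finset.mem_product, Prod.exists, not_exists, not_and] at hno
    have hno' : ∀ t ∈ T, ∀ e ∈ E, ∀ e' ∈ E, t * e ≠ g * e' := fun t ht e he e' he' h =>
      hno t e e' ⟨ht, he, he'⟩ (by rw [h]; group)
    obtain ⟨e, he⟩ := hE
    have hgT : g ∉ T := fun h => hno' g h e he e he rfl
    have hins : insert g T ∈ I.powerset.filter P := by
      refine Finset.mem_filter.2 ⟨Finset.mem_powerset.2 (Finset.insert_subset hg hTI), ?_⟩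
      intro t ht t' ht' a ha b hb hab
      rcases Finset.mem_insert.1 ht with h | h <;> rcases Finset.mem_insert.1 ht' with h' | h'
      · rw [h, h']
      · exact (hno' t' h' b hb a ha (h ▸ hab.symm)).elim
      · exact (hno' t h a ha b hb (h' ▸ hab)).elim
      · exact hTm.2 t h t' h' a ha b hb hab
    exact hgT (hT.2 hins (Finset.subset_insert _ _) (Finset.mem_insert_self _ _))
  calc I.card ≤ _ := Finset.card_le_card hcov
    _ ≤ _ := Finset.card_image_le
    _ = _ := by rw [Finset.card_product, Finset.card_product]

namespace IsFolnerSequence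

variable {G : Type*} [Group G] [DecidableEq G] {F : ℕ → Finset G}

theorem eventually_card_symmDiff_le (hF : IsFolnerSequence F) (g : G) {ε : ℝ} (hε : 0 < ε) :
    ∀ᶠ n in atTop, ((symmDiff ((F n).image (fun f => f * g)) (F n)).card : ℝ) <
      ε * (F n).card := by
  filter_upwards [(hF.2 g).eventually (gt_mem_nhds hε)] with n hn
  have : (0 : ℝ) < (F n).card := by exact_mod_cast (hF.1 n).card_pos
  rwa [div_lt_iff₀ this] at hn

/-- Approximate invariance of a small set is exact: if `|F n| < K`, a symmetric difference of
relative size below `1 / (K + 1)` is empty. Then `F n` is invariant under `K` chosen elements and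
contains `K` translates of one of its points. -/
theorem tendsto_card [Infinite G] (hF : IsFolnerSequence F) :
    Tendsto (fun n => (F n).card) atTop atTop := by
  refine tendsto_atTop.2 fun K => ?_
  obtain ⟨S, hS⟩ := Infinite.exists_subset_card_eq G K
  have h : ∀ᶠ n in atTop, ∀ g ∈ S, ((symmDiff ((F n).image (fun f => f * g)) (F n)).card : ℝ) <
      (1 / (K + 1)) * (F n).card :=
    (Finset.eventually_all S).2 fun g _ => hF.eventually_card_symmDiff_le g (by positivity)
  filter_upwards [h] with n hn
  by_contra! hlt
  obtain ⟨f, hf⟩ := hF.1 n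
  have hsub : S.image (fun g => f * g) ⊆ F n := by
    intro a ha
    obtain ⟨g, hg, rfl⟩ := Finset.mem_image.1 ha
    have h1 := hn g hg
    have h2 : (1 / ((K : ℝ) + 1)) * (F n).card ≤ 1 := by
      rw [one_div_mul_eq_div, div_le_one (by positivity)]
      have : ((F n).card : ℝ) < K := by exact_mod_cast hlt
      linarith
    have h3 : (symmDiff ((F n).image (fun f => f * g)) (F n)).card = 0 := by
      have : ((symmDiff ((F n).image (fun f => f * g)) (F n)).card : ℝ) < 1 := h1.trans_le h2
      exact Nat.lt_one_iff.1 (by exact_mod_cast this)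
    rw [Finset.card_eq_zero] at h3
    have h4 : (F n).image (fun f => f * g) = F n := symmDiff_eq_bot.1 h3
    rw [← h4]
    exact Finset.mem_image_of_mem _ hf
  have := Finset.card_le_card hsub
  rw [Finset.card_image_of_injective _ (mul_right_injective f), hS] at this
  omega

/-- Most translates of `E` based in a Følner set are contained in it. -/
theorem eventually_card_le (hF : IsFolnerSequence F) {E : Finset G} (hE : E.Nonempty) :
    ∀ᶠ n in atTop, (F n).card ≤ 2 * ((F n).filter fun g => ∀ e ∈ E, g * e ∈ F n).card := by
  have hE0 : (0 : ℝ) < E.card := by exact_mod_cast hE.card_pos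
  -- The constant is such that the losses summed over `E` amount to at most half of `F n`.
  have h : ∀ᶠ n in atTop, ∀ g ∈ E, ((symmDiff ((F n).image (fun f => f * g)) (F n)).card : ℝ) <
      (1 / (2 * E.card)) * (F n).card :=
    (Finset.eventually_all E).2 fun g _ => hF.eventually_card_symmDiff_le g (by positivity)
  filter_upwards [h] with n hn
  have hcov : (F n).filter (fun g => ¬ ∀ e ∈ E, g * e ∈ F n) ⊆
      E.biUnion fun e => (F n).filter fun g => g * e ∉ F n := by
    intro g hg
    simp only [Finset.mem_filter, not_forall, Finset.mem_biUnion] at hg ⊢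
    obtain ⟨hg, e, he, hge⟩ := hg
    exact ⟨e, he, hg, hge⟩
  have hone : ∀ e ∈ E, (((F n).filter fun g => g * e ∉ F n).card : ℝ) ≤
      (1 / (2 * E.card)) * (F n).card := by
    intro e he
    refine le_trans ?_ (hn e he).le
    rw [← Finset.card_image_of_injective _ (mul_left_injective e)]
    refine Nat.cast_le.2 (Finset.card_le_card fun a ha => ?_)
    obtain ⟨g, hg, rfl⟩ := Finset.mem_image.1 ha
    rw [Finset.mem_filter] at hg
    exact Finset.mem_symmDiff.2 (Or.inl ⟨Finset.mem_image_of_mem _ hg.1, hg.2⟩)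
  have hbad : (((F n).filter fun g => ¬ ∀ e ∈ E, g * e ∈ F n).card : ℝ) ≤ (F n).card / 2 := by
    calc (((F n).filter fun g => ¬ ∀ e ∈ E, g * e ∈ F n).card : ℝ)
        ≤ ∑ e ∈ E, (((F n).filter fun g => g * e ∉ F n).card : ℝ) := by
          exact_mod_cast (Finset.card_le_card hcov).trans Finset.card_biUnion_le
      _ ≤ E.card • ((1 / (2 * (E.card : ℝ))) * (F n).card) := Finset.sum_le_card_nsmul _ _ _ hone
      _ = (F n).card / 2 := by rw [nsmul_eq_mul]; field_simp
  have hsum := Finset.card_filter_add_card_filter_not (s := F n) fun g => ∀ e ∈ E, g * e ∈ F n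
  have hsum' : (((F n).filter fun g => ∀ e ∈ E, g * e ∈ F n).card : ℝ) +
      ((F n).filter fun g => ¬ ∀ e ∈ E, g * e ∈ F n).card = (F n).card := by exact_mod_cast hsum
  have : ((F n).card : ℝ) ≤ 2 * ((F n).filter fun g => ∀ e ∈ E, g * e ∈ F n).card := by linarith
  exact_mod_cast this

end IsFolnerSequence

/-- Ensures that the truncated exponent `B.card - T.card * E.card` is a true difference. -/
theorem card_mul_card_le_of_disjoint_translates {G : Type*} [Group G] {E B T : Finset G}
    (hT : ∀ t ∈ T, ∀ e ∈ E, t * e ∈ B)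
    (hdisj : ∀ t ∈ T, ∀ t' ∈ T, ∀ e ∈ E, ∀ e' ∈ E, t * e = t' * e' → t = t') :
    T.card * E.card ≤ B.card := by
  rw [← Finset.card_product]
  refine Finset.card_le_card_of_injOn (fun a => a.1 * a.2) (fun a ha => ?_) fun a ha b hb hab => ?_
  · have ha := Finset.mem_product.1 ha
    exact hT _ ha.1 _ ha.2
  · have ha := Finset.mem_product.1 ha
    have hb := Finset.mem_product.1 hb
    have h : a.1 = b.1 := hdisj _ ha.1 _ hb.1 _ ha.2 _ hb.2 hab
    exact Prod.ext h (mul_left_cancel (a := b.1) ((congrArg (· * a.2) h.symm).trans hab))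

/-! ### The complexity deficit of configurations avoiding a pattern -/

theorem size_le_logb_add_one (N : ℕ) : (Nat.size N : ℝ) ≤ Real.logb 2 N + 1 := by
  have h : Nat.size N ≤ Nat.log 2 N + 1 :=
    Nat.size_le.2 (Nat.lt_pow_succ_log_self one_lt_two N)
  have h' : (Nat.size N : ℝ) ≤ Nat.log 2 N + 1 := by exact_mod_cast h
  have := Real.natLog_le_logb N 2
  push_cast at this
  linarith

/-- The natural choice `2 ^ (-δ) = 1 - a ^ (-e)` degenerates when `a ^ e = 1`; halving the
subtracted term keeps the logarithm finite. -/
theorem exists_saving {a : ℕ} (ha : 0 < a) (e : ℕ) :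
    ∃ δ : ℝ, 0 < δ ∧ ((a ^ e - 1 : ℕ) : ℝ) ≤ (a : ℝ) ^ e * (2 : ℝ) ^ (-δ) := by
  have hae : (1 : ℝ) ≤ (a : ℝ) ^ e := one_le_pow₀ (by exact_mod_cast ha)
  have hinv : ((a : ℝ) ^ e)⁻¹ ≤ 1 := inv_le_one_of_one_le₀ hae
  have hinv0 : 0 < ((a : ℝ) ^ e)⁻¹ := by positivity
  refine ⟨-Real.logb 2 (1 - ((a : ℝ) ^ e)⁻¹ / 2), ?_, ?_⟩
  · rw [neg_pos]
    exact Real.logb_neg one_lt_two (by linarith) (by linarith)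
  · rw [neg_neg, Real.rpow_logb two_pos (by norm_num) (by linarith), Nat.cast_pred (by positivity)]
    push_cast
    have : (a : ℝ) ^ e * ((a : ℝ) ^ e)⁻¹ = 1 := mul_inv_cancel₀ (by positivity)
    nlinarith

/-- Each of the `t` blocks saves `δ` bits. -/
theorem logb_le_of_le_pow_mul_pow {a e t n N : ℕ} (ha : 0 < a) (hN : N ≠ 0) (hte : t * e ≤ n)
    {δ : ℝ} (hδ : ((a ^ e - 1 : ℕ) : ℝ) ≤ (a : ℝ) ^ e * (2 : ℝ) ^ (-δ))
    (h : N ≤ (a ^ e - 1) ^ t * a ^ (n - t * e)) :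
    Real.logb 2 N ≤ n * Real.logb 2 a - δ * t := by
  have ha' : (0 : ℝ) < a := by exact_mod_cast ha
  have h1 : (N : ℝ) ≤ (a : ℝ) ^ n * (2 : ℝ) ^ (-δ * t) := by
    calc (N : ℝ) ≤ ((a ^ e - 1 : ℕ) : ℝ) ^ t * (a : ℝ) ^ (n - t * e) := by exact_mod_cast h
      _ ≤ ((a : ℝ) ^ e * (2 : ℝ) ^ (-δ)) ^ t * (a : ℝ) ^ (n - t * e) := by gcongr
      _ = (a : ℝ) ^ n * (2 : ℝ) ^ (-δ * t) := by
        rw [mul_pow, ← pow_mul, Real.rpow_mul two_pos.le, Real.rpow_natCast, mul_right_comm,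
          ← pow_add, mul_comm e t, Nat.add_sub_cancel' hte]
  have h2 : Real.logb 2 N ≤ Real.logb 2 ((a : ℝ) ^ n * (2 : ℝ) ^ (-δ * t)) :=
    Real.logb_le_logb_of_le one_lt_two (by exact_mod_cast Nat.pos_of_ne_zero hN) h1
  rw [Real.logb_mul (by positivity) (by positivity), Real.logb_pow, Real.logb_rpow two_pos
    (by norm_num)] at h2
  linarith

/-- The configurations avoiding a pattern have asymptotic complexity uniformly below the
maximum. -/
theorem exists_asymptoticComplexity_le {G : Type*} [Group G] [Denumerable G] [DecidableEq G]
    (hG : IsComputableGroup G) {A : Type*} [Fintype A] [Nonempty A] [Primcodable A]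
    {U : List Bool →. ℕ} (hU : IsOptimalMachine U) {F : ℕ → Finset G}
    (hF : IsModestFolnerSequence U F) (y : G → A) {E : Finset G} (h1 : (1 : G) ∈ E) :
    ∃ δ : ℝ, 0 < δ ∧ ∀ z : G → A, (∀ g, ∃ e ∈ E, z (g * e) ≠ y e) →
      asymptoticComplexity U F z ≤ ((Real.logb 2 (Fintype.card A) - δ : ℝ) : EReal) := by
  obtain ⟨c, hc⟩ := hU.exists_complexity_le
    (computable_avoidingWords hG (Finset.univ.toList : List A) (patternList y E))
  have ha : 0 < Fintype.card A := Fintype.card_pos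
  obtain ⟨δ, hδ, hle⟩ := exists_saving ha E.card
  have hE : E.Nonempty := ⟨1, h1⟩
  have hE0 : (0 : ℝ) < E.card := by exact_mod_cast hE.card_pos
  -- A saving of `δ` per translate, times the lower bound `1 / (2|E|²)` for the density of `T` in `F
  -- n`.
  set δ' : ℝ := δ / (2 * (E.card * E.card)) with hδ'
  refine ⟨δ', by positivity, fun z hz => ?_⟩
  have hbound : ∀ᶠ n in atTop, (wordComplexity U z (F n) : ℝ) / (F n).card ≤
      2 * ((finsetComplexity U (F n) : ℝ) / (F n).card) +
        (Real.logb 2 (Fintype.card A) - δ') + (c + 1) / ((F n).card : ℝ) := by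
    filter_upwards [hF.1.eventually_card_le hE] with n hn
    obtain ⟨T, hTI, hdisj, hTcard⟩ := exists_disjoint_translates E
      ((F n).filter fun g => ∀ e ∈ E, g * e ∈ F n) hE
    have hTB : ∀ t ∈ T, ∀ e ∈ E, t * e ∈ F n := fun t ht =>
      (Finset.mem_filter.1 (hTI ht)).2
    have hmem := wordContent_mem_wordsAvoidingPattern hz (F n)
    have hN : (wordsAvoidingPattern y E (F n)).length ≠ 0 :=
      (List.length_pos_of_mem hmem).ne'
    have hlog := logb_le_of_le_pow_mul_pow ha hN
      (card_mul_card_le_of_disjoint_translates hTB hdisj) hle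
      (length_wordsAvoidingPattern_le y h1 hTB hdisj)
    have hsize := size_le_logb_add_one (wordsAvoidingPattern y E (F n)).length
    have hC : (wordComplexity U z (F n) : ℝ) ≤ 2 * (finsetComplexity U (F n) : ℝ) +
        Nat.size (wordsAvoidingPattern y E (F n)).length + c := by
      exact_mod_cast hc (finsetCode (F n)) (wordContent z (F n)) hmem
    have hT : ((F n).card : ℝ) ≤ 2 * (T.card * (E.card * E.card)) := by
      exact_mod_cast hn.trans (Nat.mul_le_mul_left 2 hTcard)
    have hsave : δ' * (F n).card ≤ δ * T.card := by
      rw [hδ', div_mul_eq_mul_div, div_le_iff₀ (by positivity)]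
      nlinarith
    have hpos : (0 : ℝ) < (F n).card := by exact_mod_cast (hF.1.1 n).card_pos
    rw [div_le_iff₀ hpos]
    field_simp
    linarith
  have hcard : Tendsto (fun n => ((F n).card : ℝ)) atTop atTop :=
    tendsto_natCast_atTop_atTop.comp hF.1.tendsto_card
  have hlim : Tendsto (fun n => 2 * ((finsetComplexity U (F n) : ℝ) / (F n).card) +
      (Real.logb 2 (Fintype.card A) - δ') + (c + 1) / ((F n).card : ℝ)) atTop
      (𝓝 (Real.logb 2 (Fintype.card A) - δ')) := by
    simpa using ((hF.2.const_mul 2).add_const (Real.logb 2 (Fintype.card A) - δ')).add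
      (hcard.const_div_atTop (c + 1 : ℝ))
  rw [← ((continuous_coe_real_ereal.tendsto _).comp hlim).limsup_eq]
  exact limsup_le_limsup (hbound.mono fun n hn => EReal.coe_le_coe_iff.2 hn)

/-! ### Configurations of maximal complexity -/

theorem wordContent_congr_iff {G A : Type*} [Denumerable G] {x y : G → A} {B : Finset G} :
    wordContent x B = wordContent y B ↔ ∀ g ∈ B, x g = y g := by
  simp only [wordContent, List.map_inj_left, mem_finsetCode]
  exact ⟨fun h g hg => by simpa using h (Encodable.encode g) (by simpa using hg),
    fun h m hm => h _ hm⟩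

/-- A configuration given on a finite set can be continued so that it is complex on `B`. -/
theorem IsOptimalMachine.exists_complex_extension {G : Type*} [Denumerable G] [DecidableEq G]
    {A : Type*} [Fintype A] [Nonempty A] [Primcodable A] {U : List Bool →. ℕ}
    (hU : IsOptimalMachine U) (x : G → A) (E B : Finset G) :
    ∃ z : G → A, (∀ g ∈ E, z g = x g) ∧
      ((B.card : ℝ) - E.card) * Real.logb 2 (Fintype.card A) - 1 ≤ wordComplexity U z B := by
  classical
  let ext : ((B \ E : Finset G) → A) → G → A := fun u g =>
    if h : g ∈ B \ E then u ⟨g, h⟩ else x g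
  let f : ((B \ E : Finset G) → A) → List ℕ × List A := fun u =>
    (finsetCode B, wordContent (ext u) B)
  have hf : Function.Injective f := by
    intro u v h
    have h' := wordContent_congr_iff.1 (congrArg Prod.snd h)
    funext g
    simpa only [ext, g.2, dite_true] using h' g (Finset.mem_sdiff.1 g.2).1
  have ha : 0 < Fintype.card A := Fintype.card_pos
  have hcard : (Finset.univ.image f).card = Fintype.card A ^ (B \ E).card := by
    rw [Finset.card_image_of_injective _ hf, Finset.card_univ, Fintype.card_fun,
      Fintype.card_coe]
  -- The free letters on `B \ E` give `a ^ |B \ E|` distinct words; rounding the logarithm down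
  -- costs the `-1` in the bound.
  obtain ⟨w, hw, hC⟩ := hU.exists_le_complexity (L := Nat.log 2 (Fintype.card A ^ (B \ E).card))
    (Finset.univ.image f) (by rw [hcard]; exact Nat.pow_log_le_self 2 (by positivity))
  obtain ⟨u, -, rfl⟩ := Finset.mem_image.1 hw
  refine ⟨ext u, fun g hg => by simp [ext, hg], ?_⟩
  have h1 : (Nat.log 2 (Fintype.card A ^ (B \ E).card) : ℝ) ≤ wordComplexity U (ext u) B := by
    exact_mod_cast hC
  have h2 : Real.logb 2 ((Fintype.card A : ℝ) ^ (B \ E).card) ≤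
      Nat.log 2 (Fintype.card A ^ (B \ E).card) + 1 := by
    have h := Nat.lt_pow_succ_log_self one_lt_two (Fintype.card A ^ (B \ E).card)
    have h' : ((Fintype.card A : ℝ) ^ (B \ E).card) ≤
        (2 : ℝ) ^ (Nat.log 2 (Fintype.card A ^ (B \ E).card) + 1) := by exact_mod_cast h.le
    have h'' := Real.logb_le_logb_of_le one_lt_two (by positivity) h'
    rw [Real.logb_pow 2 2, Real.logb_self_eq_one one_lt_two, mul_one] at h''
    exact_mod_cast h''
  rw [Real.logb_pow] at h2
  have h3 : (B.card : ℝ) - E.card ≤ (B \ E).card := by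
    have := Finset.le_card_sdiff E B
    have : B.card ≤ (B \ E).card + E.card := by omega
    have : (B.card : ℝ) ≤ (B \ E).card + E.card := by exact_mod_cast this
    linarith
  have h4 : 0 ≤ Real.logb 2 (Fintype.card A) :=
    Real.logb_nonneg one_lt_two (by exact_mod_cast ha)
  have := mul_le_mul_of_nonneg_right h3 h4
  linarith

/-- Some (indeed a generic) configuration has maximal asymptotic complexity. -/
theorem IsOptimalMachine.exists_le_asymptoticComplexity {G : Type*} [Denumerable G] {A : Type*}
    [Fintype A] [Nonempty A] [Primcodable A] {U : List Bool →. ℕ} (hU : IsOptimalMachine U)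
    {F : ℕ → Finset G} (hF : Tendsto (fun n => (F n).card) atTop atTop) :
    ∃ x : G → A, ((Real.logb 2 (Fintype.card A) : ℝ) : EReal) ≤ asymptoticComplexity U F x := by
  classical
  let _ : TopologicalSpace A := ⊥
  have : DiscreteTopology A := ⟨rfl⟩
  let D : ℕ → Set (G → A) := fun N => {x | ∃ n ≥ N,
    Real.logb 2 (Fintype.card A) - 1 / (N + 1) ≤ (wordComplexity U x (F n) : ℝ) / (F n).card}
  have hopen : ∀ N, IsOpen (D N) := by
    intro N
    refine isOpen_pi_iff.2 fun x hx => ?_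
    obtain ⟨n, hn, hx⟩ := hx
    refine ⟨F n, fun g => {x g}, fun g _ => ⟨isOpen_discrete _, rfl⟩, fun z hz => ⟨n, hn, ?_⟩⟩
    have : wordContent z (F n) = wordContent x (F n) := wordContent_congr_iff.2 fun g hg => hz g hg
    rwa [wordComplexity, this]
  have hdense : ∀ N, Dense (D N) := by
    intro N
    refine dense_iff_inter_open.2 fun V hV hne => ?_
    obtain ⟨x, hx⟩ := hne
    obtain ⟨E, u, hu, hsub⟩ := isOpen_pi_iff.1 hV x hx
    have hcard : Tendsto (fun n => ((F n).card : ℝ)) atTop atTop :=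
      tendsto_natCast_atTop_atTop.comp hF
    -- Fixing the letters on `E` and rounding lose at most `|E| log₂ a + 1` bits, which must not
    -- exceed `|F n| / (N + 1)`.
    obtain ⟨n, hn, hnN, hpos⟩ := ((hcard.eventually_ge_atTop
      ((N + 1) * (E.card * Real.logb 2 (Fintype.card A) + 1))).and
      ((eventually_ge_atTop N).and (hcard.eventually_gt_atTop 0))).exists
    obtain ⟨z, hz, hC⟩ := hU.exists_complex_extension x E (F n)
    refine ⟨z, hsub fun g hg => ?_, n, hnN, ?_⟩
    · rw [hz g hg]; exact (hu g hg).2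
    · rw [le_div_iff₀ hpos]
      have h : (E.card * Real.logb 2 (Fintype.card A) + 1) ≤ 1 / ((N : ℝ) + 1) * (F n).card := by
        rw [one_div_mul_eq_div, le_div_iff₀ (by positivity)]
        linarith
      linarith
  -- Baire category theorem in the compact Hausdorff space `G → A`.
  obtain ⟨x, hx⟩ := (dense_iInter_of_isOpen_nat hopen hdense).nonempty
  refine ⟨x, le_of_forall_lt_imp_le_of_dense fun b hb => ?_⟩
  obtain ⟨r, hbr, hr⟩ := EReal.lt_iff_exists_real_btwn.1 hb
  refine hbr.le.trans
    (le_limsup_of_frequently_le (frequently_atTop.2 fun M => ?_) (by isBoundedDefault))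
  have hr' : r < Real.logb 2 (Fintype.card A) := EReal.coe_lt_coe_iff.1 hr
  obtain ⟨K, hK⟩ := exists_nat_one_div_lt (sub_pos.2 hr')
  -- `M` makes the index late enough, `K` makes the error smaller than `log₂ a - r`.
  obtain ⟨n, hn, hxn⟩ := Set.mem_iInter.1 hx (max M K)
  refine ⟨n, (le_max_left _ _).trans hn, EReal.coe_le_coe_iff.2 (le_trans ?_ hxn)⟩
  have : 1 / (((max M K : ℕ) : ℝ) + 1) ≤ 1 / ((K : ℝ) + 1) :=
    one_div_le_one_div_of_le (by positivity) (by gcongr; exact le_max_right _ _)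
  linarith

theorem mainTheorem2 {G : Type*} [Group G] [Denumerable G] [DecidableEq G]
    (hG : IsComputableGroup G)
    {A : Type*} [Finite A] [Primcodable A]
    (U : List Bool →. ℕ) (hU : IsOptimalMachine U)
    (F : ℕ → Finset G) (hF : IsModestFolnerSequence U F)
    (τ : (G → A) → (G → A)) (hτ : IsCellularAutomaton τ)
    (hGOE : ∃ y : G → A, IsGardenOfEden τ y) :
    ∃ x : G → A, asymptoticComplexity U F (τ x) < asymptoticComplexity U F x := by
  have := Fintype.ofFinite A
  have : Infinite G := (Denumerable.eqv G).infinite_iff.2 inferInstance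
  obtain ⟨y, hy⟩ := hGOE
  have : Nonempty A := ⟨y 1⟩
  obtain ⟨E, h1, hE⟩ := hτ.exists_avoided_pattern hy
  -- `δ` serves all avoiding configurations at once, so `x` can be chosen without regard to `τ`.
  obtain ⟨δ, hδ, hle⟩ := exists_asymptoticComplexity_le hG hU hF y h1
  obtain ⟨x, hx⟩ := hU.exists_le_asymptoticComplexity (A := A) hF.1.tendsto_card
  refine ⟨x, (hle (τ x) (hE x)).trans_lt (lt_of_lt_of_le ?_ hx)⟩
  exact EReal.coe_lt_coe_iff.2 (by linarith)
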